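/- A \emph{monoidal monad} in a monoidal category $\langle\mathcal A,\otimes,I,a,l,r\rangle$ is a monad $\langle T,\eta,\mu\rangle$ in $\mathcal A$ with natural transformations $\psi^L_{A,B}\colon TA\otimes B\to T(A\otimes B)$ and $\psi^R_{A,B}\colon A\otimes TB\to T(A\otimes B)$ such that \[ \begin{aligned} &Ta_{A,B,C}\circ\psi^L_{A\otimes B,C}\circ(\psi^L_{A,B}\otimes\mathbf 1_C)=\psi^L_{A,B\otimes C}\circ a_{TA,B,C}, && Tr_A\circ\psi^L_{A,I}=r_{TA},\\ &\psi^L_{A,B}\circ(\eta_A\otimes\mathbf 1_B)=\eta_{A\otimes B}, && \psi^L_{A,B}\circ(\mu_A\otimes\mathbf 1_B)=\mu_{A\otimes B}\circ T\psi^L_{A,B}\circ\psi^L_{TA,B},\\ &Ta_{A,B,C}\circ\psi^R_{A\otimes B,C}=\psi^R_{A,B\otimes C}\circ(\mathbf 1_A\otimes\psi^R_{B,C})\circ a_{A,B,TC}, && Tl_A\circ\psi^R_{I,A}=l_{TA},\\ &\psi^R_{A,B}\circ(\mathbf 1_A\otimes\eta_B)=\eta_{A\otimes B}, && \psi^R_{A,B}\circ(\mathbf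 1_A\otimes\mu_B)=\mu_{A\otimes B}\circ T\psi^R_{A,B}\circ\psi^R_{A,TB}, \end{aligned} \] \[ Ta_{A,B,C}\circ\psi^L_{A\otimes B,C}\circ(\psi^R_{A,B}\otimes\mathbf 1_C)=\psi^R_{A,B\otimes C}\circ(\mathbf 1_A\otimes\psi^L_{B,C})\circ a_{A,TB,C}, \] \[ \mu_{A\otimes B}\circ T\psi^L_{A,B}\circ\psi^R_{TA,B}=\mu_{A\otimes B}\circ T\psi^R_{A,B}\circ\psi^L_{A,TB}. \] Write $\psi_{A,B}\colon TA\otimes TB\to T(A\otimes B)$ for the common value of the two sides of the last equation. A \emph{cocartesian monoidal monad} is a monoidal monad in a symmetric monoidal category (with symmetry $c$) whose monoidal structure is given by finite coproducts ($I$ is initial, with unique arrows $!_A\colon I\to A$, and $A\otimes B$ is the coproduct of $A$ and $B$, with injections $\iota^1_{A,B},\iota^2_{A,B}$ and codiagonals $\nabla_A\colon A\otimes A\to A$), such that \[ Tc_{A,B}\circ\psi^L_{A,B}=\psi^R_{B,A}\circ c_{TA,B}\qquad\text{and}\qquad \psi_{A,B}=\nabla_{T(A\otimes B)}\circ(T\iota^1_{A,B}\otimes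 T\iota^2_{A,B}). \] (Equivalently: a category with finite coproducts carrying a monad, with $\psi$ defined by the last equation.) Let $P$ be an arbitrary set, and let $\mathcal{DS}$ be the category of the cocartesian monoidal monad freely generated by $P$ as set of objects. Its objects are the formulae built from the letters $p\in P$ and $I$ with $\otimes$ and $T$; its arrows are the arrow terms built from $\mathbf 1,a,a^{-1},l,l^{-1},r,r^{-1},c,\nabla,!,\eta,\mu,\psi^L,\psi^R$ with $\circ$, $\otimes$ and $T$, modulo the congruence generated by the equations of cocartesian monoidal monads. Let $\mathit{Fun}$ be the category whose objects are the finite ordinals and whose arrows are arbitrary functions between them. The functor $G\colon\mathcal{DS}\to\mathit{Fun}$ is defined as follows. $GA$ is the number of occurrences of letters plus the number of occurrences of $T$ in $A$; the elements of the ordinal $GA$ correspond to these occurrences, numbered from right to left. On arrows, $G$ preserves identities and composition. $G(f\otimes g)$ acts as $Gf$ on the occurrences in the left factor and as $Gg$ on those in the right factor. $G(Tf)$ sends the outermost $T$ to the outermost $T$ and is $Gf$ on the other occurrences. $Ga,Gl,Gr,Gc,G\psi^L,G\psi^R$ (and $Ga^{-1},Gl^{-1},Gr^{-1}$) send each occurrence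 of a letter or of $T$ in the source to the corresponding occurrence in the target. $G\eta_A\colon GA\to G(TA)$ is the inclusion missing the outermost $T$. $G\mu_A\colon G(TTA)\to G(TA)$ sends the two outermost occurrences of $T$ to the outermost $T$ and is the identity on the occurrences in $A$. $G\nabla_A$ identifies the two copies of each occurrence of $A\otimes A$. $G!_A$ is the empty function. Then the functor $G\colon\mathcal{DS}\to\mathit{Fun}$ is faithful. -/

import Mathlib

open CategoryTheory

namespace CocartesianMonad

universe u

/-- Objects of the free structure: propositional formulae built from the generating objects
(letters) `p : P` with the unit object `I`, the binary operation `⊗` and the unary operation `T`. -/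
inductive Obj (P : Type u) : Type u
  | letter (p : P) : Obj P
  | unit : Obj P
  | tensor (A B : Obj P) : Obj P
  | T (A : Obj P) : Obj P

local infixr:70 " ⊠ " => Obj.tensor

/-- The primitive arrow terms of a symmetric monoidal monad in a cocartesian category.
`comp g f` is the composite `g ∘ f` and `tensor f g` is `f ⊗ g`. -/
inductive Term {P : Type u} : Obj P → Obj P → Type u
  | one (A : Obj P) : Term A A
  | comp {A B C : Obj P} (g : Term B C) (f : Term A B) : Term A C
  | tensor {A B C D : Obj P} (f : Term A B) (g : Term C D) : Term (A ⊠ C) (B ⊠ D)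
  | a (A B C : Obj P) : Term ((A ⊠ B) ⊠ C) (A ⊠ (B ⊠ C))
  | aInv (A B C : Obj P) : Term (A ⊠ (B ⊠ C)) ((A ⊠ B) ⊠ C)
  | l (A : Obj P) : Term (.unit ⊠ A) A
  | lInv (A : Obj P) : Term A (.unit ⊠ A)
  | r (A : Obj P) : Term (A ⊠ .unit) A
  | rInv (A : Obj P) : Term A (A ⊠ .unit)
  | c (A B : Obj P) : Term (A ⊠ B) (B ⊠ A)
  /-- the codiagonal `∇_A : A ⊗ A → A` -/
  | codiag (A : Obj P) : Term (A ⊠ A) A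
  /-- the arrow `!_A : I → A` out of the initial object -/
  | bang (A : Obj P) : Term .unit A
  | T {A B : Obj P} (f : Term A B) : Term A.T B.T
  | η (A : Obj P) : Term A A.T
  | μ (A : Obj P) : Term A.T.T A.T
  | ψL (A B : Obj P) : Term (A.T ⊠ B) (A ⊠ B).T
  | ψR (A B : Obj P) : Term (A ⊠ B.T) (A ⊠ B).T

local infixr:80 " ⊚ " => Term.comp
local infixr:85 " ⊛ " => Term.tensor

namespace Term

variable {P : Type u}

/-- The first injection `ι¹ : A → A ⊗ B`, namely `A ≅ A ⊗ I → A ⊗ B`. -/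
def inj₁ (A B : Obj P) : Term A (A ⊠ B) := (one A ⊛ bang B) ⊚ rInv A

/-- The second injection `ι² : B → A ⊗ B`, namely `B ≅ I ⊗ B → A ⊗ B`. -/
def inj₂ (A B : Obj P) : Term B (A ⊠ B) := (bang A ⊛ one B) ⊚ lInv B

/-- The arrow `ψ_{A,B} : TA ⊗ TB → T(A ⊗ B)` of a monoidal monad, in terms of `ψL` and `ψR`. -/
def ψ (A B : Obj P) : Term (A.T ⊠ B.T) (A ⊠ B).T :=
  μ (A ⊠ B) ⊚ T (ψL A B) ⊚ ψR A.T B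

end Term

open Term in
/-- Equality of arrow terms: the congruence generated by the equations of cocartesian
monoidal monads. -/
inductive Eqv {P : Type u} : ∀ {A B : Obj P}, Term A B → Term A B → Prop
  -- equivalence relation and congruence
  | refl {A B : Obj P} (f : Term A B) : Eqv f f
  | symm {A B : Obj P} {f g : Term A B} : Eqv f g → Eqv g f
  | trans {A B : Obj P} {f g h : Term A B} : Eqv f g → Eqv g h → Eqv f h
  | comp_congr {A B C : Obj P} {g g' : Term B C} {f f' : Term A B} :
      Eqv g g' → Eqv f f' → Eqv (g ⊚ f) (g' ⊚ f')
  | tensor_congr {A B C D : Obj P} {f f' : Term A B} {g g' : Term C D} :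
      Eqv f f' → Eqv g g' → Eqv (f ⊛ g) (f' ⊛ g')
  | T_congr {A B : Obj P} {f f' : Term A B} : Eqv f f' → Eqv (T f) (T f')
  -- category
  | id_comp {A B : Obj P} (f : Term A B) : Eqv (one B ⊚ f) f
  | comp_id {A B : Obj P} (f : Term A B) : Eqv (f ⊚ one A) f
  | assoc {A B C D : Obj P} (h : Term C D) (g : Term B C) (f : Term A B) :
      Eqv ((h ⊚ g) ⊚ f) (h ⊚ (g ⊚ f))
  -- `⊗` is a bifunctor
  | tensor_id (A B : Obj P) : Eqv (one A ⊛ one B) (one (A ⊠ B))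
  | tensor_comp {A B C A' B' C' : Obj P} (g : Term B C) (f : Term A B)
      (g' : Term B' C') (f' : Term A' B') :
      Eqv ((g ⊚ f) ⊛ (g' ⊚ f')) ((g ⊛ g') ⊚ (f ⊛ f'))
  -- monoidal structure
  | a_nat {A B C A' B' C' : Obj P} (f : Term A A') (g : Term B B') (h : Term C C') :
      Eqv (a A' B' C' ⊚ ((f ⊛ g) ⊛ h)) ((f ⊛ (g ⊛ h)) ⊚ a A B C)
  | a_aInv (A B C : Obj P) : Eqv (a A B C ⊚ aInv A B C) (one _)
  | aInv_a (A B C : Obj P) : Eqv (aInv A B C ⊚ a A B C) (one _)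
  | l_nat {A B : Obj P} (f : Term A B) : Eqv (l B ⊚ (one .unit ⊛ f)) (f ⊚ l A)
  | l_lInv (A : Obj P) : Eqv (l A ⊚ lInv A) (one _)
  | lInv_l (A : Obj P) : Eqv (lInv A ⊚ l A) (one _)
  | r_nat {A B : Obj P} (f : Term A B) : Eqv (r B ⊚ (f ⊛ one .unit)) (f ⊚ r A)
  | r_rInv (A : Obj P) : Eqv (r A ⊚ rInv A) (one _)
  | rInv_r (A : Obj P) : Eqv (rInv A ⊚ r A) (one _)
  | pentagon (A B C D : Obj P) :
      Eqv (a A B (C ⊠ D) ⊚ a (A ⊠ B) C D)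
        ((one A ⊛ a B C D) ⊚ a A (B ⊠ C) D ⊚ (a A B C ⊛ one D))
  | triangle (A B : Obj P) : Eqv ((one A ⊛ l B) ⊚ a A .unit B) (r A ⊛ one B)
  -- symmetry
  | c_nat {A B A' B' : Obj P} (f : Term A A') (g : Term B B') :
      Eqv (c A' B' ⊚ (f ⊛ g)) ((g ⊛ f) ⊚ c A B)
  | c_c (A B : Obj P) : Eqv (c B A ⊚ c A B) (one _)
  | hexagon (A B C : Obj P) :
      Eqv (a B C A ⊚ c A (B ⊠ C) ⊚ a A B C)
        ((one B ⊛ c A C) ⊚ a B A C ⊚ (c A B ⊛ one C))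
  -- cocartesian structure: `I` is initial, and `A ⊗ B` is a coproduct of `A` and `B`
  | bang_nat {A B : Obj P} (f : Term A B) : Eqv (f ⊚ bang A) (bang B)
  | bang_unit : Eqv (bang .unit) (one .unit)
  | codiag_nat {A B : Obj P} (f : Term A B) : Eqv (f ⊚ codiag A) (codiag B ⊚ (f ⊛ f))
  | codiag_inj₁ (A : Obj P) : Eqv (codiag A ⊚ inj₁ A A) (one A)
  | codiag_inj₂ (A : Obj P) : Eqv (codiag A ⊚ inj₂ A A) (one A)
  | codiag_inj (A B : Obj P) : Eqv (codiag (A ⊠ B) ⊚ (inj₁ A B ⊛ inj₂ A B)) (one (A ⊠ B))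
  -- `T` is a functor, and `(T, η, μ)` is a monad
  | T_id (A : Obj P) : Eqv (T (one A)) (one A.T)
  | T_comp {A B C : Obj P} (g : Term B C) (f : Term A B) : Eqv (T (g ⊚ f)) (T g ⊚ T f)
  | η_nat {A B : Obj P} (f : Term A B) : Eqv (T f ⊚ η A) (η B ⊚ f)
  | μ_nat {A B : Obj P} (f : Term A B) : Eqv (T f ⊚ μ A) (μ B ⊚ T (T f))
  | μ_η (A : Obj P) : Eqv (μ A ⊚ η A.T) (one A.T)
  | μ_Tη (A : Obj P) : Eqv (μ A ⊚ T (η A)) (one A.T)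
  | μ_μ (A : Obj P) : Eqv (μ A ⊚ μ A.T) (μ A ⊚ T (μ A))
  -- left strong monad
  | ψL_nat {A B A' B' : Obj P} (f : Term A A') (g : Term B B') :
      Eqv (T (f ⊛ g) ⊚ ψL A B) (ψL A' B' ⊚ (T f ⊛ g))
  | ψL_a (A B C : Obj P) :
      Eqv (T (a A B C) ⊚ ψL (A ⊠ B) C ⊚ (ψL A B ⊛ one C)) (ψL A (B ⊠ C) ⊚ a A.T B C)
  | ψL_r (A : Obj P) : Eqv (T (r A) ⊚ ψL A .unit) (r A.T)
  | ψL_η (A B : Obj P) : Eqv (ψL A B ⊚ (η A ⊛ one B)) (η (A ⊠ B))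
  | ψL_μ (A B : Obj P) :
      Eqv (ψL A B ⊚ (μ A ⊛ one B)) (μ (A ⊠ B) ⊚ T (ψL A B) ⊚ ψL A.T B)
  -- right strong monad
  | ψR_nat {A B A' B' : Obj P} (f : Term A A') (g : Term B B') :
      Eqv (T (f ⊛ g) ⊚ ψR A B) (ψR A' B' ⊚ (f ⊛ T g))
  | ψR_a (A B C : Obj P) :
      Eqv (T (a A B C) ⊚ ψR (A ⊠ B) C) (ψR A (B ⊠ C) ⊚ (one A ⊛ ψR B C) ⊚ a A B C.T)
  | ψR_l (A : Obj P) : Eqv (T (l A) ⊚ ψR .unit A) (l A.T)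
  | ψR_η (A B : Obj P) : Eqv (ψR A B ⊚ (one A ⊛ η B)) (η (A ⊠ B))
  | ψR_μ (A B : Obj P) :
      Eqv (ψR A B ⊚ (one A ⊛ μ B)) (μ (A ⊠ B) ⊚ T (ψR A B) ⊚ ψR A B.T)
  -- locally monoidal endofunctor, monoidal monad, symmetric monoidal monad
  | ψL_ψR_a (A B C : Obj P) :
      Eqv (T (a A B C) ⊚ ψL (A ⊠ B) C ⊚ (ψR A B ⊛ one C))
        (ψR A (B ⊠ C) ⊚ (one A ⊛ ψL B C) ⊚ a A B.T C)
  | ψL_ψR_μ (A B : Obj P) :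
      Eqv (μ (A ⊠ B) ⊚ T (ψL A B) ⊚ ψR A.T B) (μ (A ⊠ B) ⊚ T (ψR A B) ⊚ ψL A B.T)
  | ψL_ψR_c (A B : Obj P) : Eqv (T (c A B) ⊚ ψL A B) (ψR B A ⊚ c A.T B)
  -- cocartesian monoidal monad: `ψ` comes from the codiagonal and the injections
  | ψ_def (A B : Obj P) :
      Eqv (ψ A B) (codiag (A ⊠ B).T ⊚ (T (inj₁ A B) ⊛ T (inj₂ A B)))

/-- Equality of arrow terms as a setoid on the arrow terms of a given type. -/
instance termSetoid {P : Type u} (A B : Obj P) : Setoid (Term A B) where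
  r := Eqv
  iseqv := ⟨Eqv.refl, Eqv.symm, Eqv.trans⟩

/-- The category `DS` of the cocartesian monoidal monad freely generated by the set of objects
`P`: its arrows are the arrow terms modulo equality of arrow terms. -/
def DS (P : Type u) : Type u := Obj P

instance (P : Type u) : Category.{u} (DS P) where
  Hom A B := Quotient (termSetoid (P := P) A B)
  id A := Quotient.mk _ (Term.one A)
  comp f g := Quotient.map₂ (fun f g => g ⊚ f) (fun _ _ hf _ _ hg => Eqv.comp_congr hg hf) f g
  id_comp f := Quotient.inductionOn f fun f => Quotient.sound (Eqv.comp_id f)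
  comp_id f := Quotient.inductionOn f fun f => Quotient.sound (Eqv.id_comp f)
  assoc f g h := Quotient.inductionOn₃ f g h fun f g h =>
    Quotient.sound (Eqv.symm (Eqv.assoc h g f))

section Graph

variable {P : Type u}

/-- `GA`: the number of occurrences of letters plus the number of occurrences of `T` in `A`. -/
def occ : Obj P → ℕ
  | .letter _ => 1
  | .unit => 0
  | .tensor A B => occ A + occ B
  | .T A => occ A + 1

/-- The set of occurrences of letters and of `T` in `A`; for `TA`, the outermost `T` is `none`. -/
def Pos : Obj P → Type
  | .letter _ => Unit
  | .unit => Empty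
  | .tensor A B => Pos A ⊕ Pos B
  | .T A => Option (Pos A)

/-- The numbering of the occurrences in `A` by the ordinal `GA`, from right to left:
the rightmost occurrence is number `0`. -/
def posEquiv : (A : Obj P) → Pos A ≃ Fin (occ A)
  | .letter _ => (Equiv.ofUnique Unit (Fin 1) : Unit ≃ Fin 1)
  | .unit => (Equiv.equivOfIsEmpty Empty (Fin 0) : Empty ≃ Fin 0)
  | .tensor A B =>
      ((Equiv.sumComm (Pos A) (Pos B)).trans
        (Equiv.sumCongr (posEquiv B) (posEquiv A))).trans
        (finSumFinEquiv.trans (finCongr (Nat.add_comm (occ B) (occ A))))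
  | .T A => (Equiv.optionCongr (posEquiv A)).trans finSuccEquivLast.symm

/-- The function on occurrences given by an arrow term: the picture of `Gf`. -/
def act : {A B : Obj P} → Term A B → Pos A → Pos B
  | _, _, .one _ => fun x => x
  | _, _, .comp g f => fun x => act g (act f x)
  | _, _, .tensor f g => Sum.map (act f) (act g)
  | _, _, .a A B C => Equiv.sumAssoc (Pos A) (Pos B) (Pos C)
  | _, _, .aInv A B C => (Equiv.sumAssoc (Pos A) (Pos B) (Pos C)).symm
  | _, _, .l A => (Equiv.emptySum Empty (Pos A) : Empty ⊕ Pos A ≃ Pos A)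
  | _, _, .lInv _ => Sum.inr
  | _, _, .r A => (Equiv.sumEmpty (Pos A) Empty : Pos A ⊕ Empty ≃ Pos A)
  | _, _, .rInv _ => Sum.inl
  | _, _, .c _ _ => Sum.swap
  | _, _, .codiag _ => Sum.elim (fun x => x) (fun x => x)
  | _, _, .bang _ => fun x : Empty => x.elim
  | _, _, .T f => Option.map (act f)
  | _, _, .η _ => some
  | _, _, .μ A => fun x : Option (Option (Pos A)) => x.join
  | _, _, .ψL A B => fun x : Option (Pos A) ⊕ Pos B =>
      Sum.elim (Option.map Sum.inl) (fun y => some (Sum.inr y)) x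
  | _, _, .ψR A B => fun x : Pos A ⊕ Option (Pos B) =>
      Sum.elim (fun y => some (Sum.inl y)) (Option.map Sum.inr) x

/-- `Gf : GA → GB` for an arrow term `f : A → B`. -/
def graph {A B : Obj P} (f : Term A B) : Fin (occ A) → Fin (occ B) :=
  fun i => posEquiv B (act f ((posEquiv A).symm i))

/-- Equal arrow terms give the same function on occurrences. -/
theorem act_eq {A B : Obj P} {f g : Term A B} (h : Eqv f g) : act f = act g := by
  induction h with
  | refl => rfl
  | symm _ ih => exact ih.symm
  | trans _ _ ih₁ ih₂ => exact ih₁.trans ih₂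
  | comp_congr _ _ ih₁ ih₂ => exact congrArg₂ (fun g f x => g (f x)) ih₁ ih₂
  | tensor_congr _ _ ih₁ ih₂ => exact congrArg₂ (fun g f => Sum.map g f) ih₁ ih₂
  | T_congr _ ih => exact congrArg (fun f => Option.map f) ih
  | _ =>
    funext x
    revert x
    repeat' first
      | exact rfl
      | exact fun x => rfl
      | exact fun x => Empty.elim x
      | (intro x; rcases x with x | x <;> try revert x)

theorem graph_eq {A B : Obj P} {f g : Term A B} (h : Eqv f g) : graph f = graph g := by
  funext i
  exact congrArg (fun k => posEquiv B (k ((posEquiv A).symm i))) (act_eq h)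

end Graph

/-- The functor `G` from `DS` to the category of functions between finite ordinals. -/
def G (P : Type u) : DS P ⥤ FintypeCat.Skeleton.{0} where
  obj A := FintypeCat.Skeleton.mk (occ (P := P) A)
  map {A B} f := fun i => ULift.up
    (Quotient.lift (s := termSetoid (P := P) A B) (fun t => graph t)
      (fun _ _ h => graph_eq h) f i.down)
  map_id A := by
    funext i
    exact congrArg ULift.up ((posEquiv (P := P) A).apply_symm_apply i.down)
  map_comp {A B C} f g := by
    refine Quotient.inductionOn₂ (s₁ := termSetoid (P := P) A B)
      (s₂ := termSetoid (P := P) B C) f g fun f g => ?_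
    funext i
    refine congrArg ULift.up ?_
    change posEquiv C _ = posEquiv C (act g ((posEquiv B).symm (posEquiv B _)))
    rw [Equiv.symm_apply_apply]
    rfl

end CocartesianMonad

namespace CocartesianMonad

open Term MonoidalCategory

local infixr:70 " ⊠ " => Obj.tensor
local infixr:80 " ⊚ " => Term.comp
local infixr:85 " ⊛ " => Term.tensor

universe v

variable {P : Type v}

/-! Faithfulness follows from a normal form for arrows out of a letter or a formula `T A`. Each
occurrence `y` of a letter or of `T` in `D` has a canonical arrow into `D`, built from injections
and `η`, whose source is the subformula headed by `y` (`can`). Every arrow from a letter is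
canonical, and every arrow `T A → D` is `k ∘ μ ∘ T g` with `k : T C → D` canonical and `g : A → T
C`.

The normal form comes from `isNormal_can_comp`: an induction on `f` shows that canonical arrows
followed by `f` are normal. Composition works because Kleisli extensions compose
(`IsNormal.ext_comp`, `IsNormal.comp`); the strengths work because the coproduct injections reduce
them to `T ι` and `η`.

Arrows with the same function are then equal by induction on the source. Units and tensors are
handled by the universal property of coproducts. For a letter or `T A`, the image of the outermost
symbol determines `y`, hence `k`; since `k` acts injectively, the function of `g` is also
determined, and the induction hypothesis applies to `g`. -/

/-! ### The free category as a symmetric monoidal category. -/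

instance : Category (Obj P) := inferInstanceAs (Category (DS P))

/-- The arrow of the free category represented by an arrow term. -/
def arr {A B : Obj P} (f : Term A B) : A ⟶ B := Quotient.mk (termSetoid A B) f

theorem arr_surjective {A B : Obj P} (h : A ⟶ B) : ∃ f : Term A B, arr f = h :=
  Quotient.exists_rep h

theorem arr_eq {A B : Obj P} {f g : Term A B} (h : Eqv f g) : arr f = arr g :=
  Quotient.sound h

theorem arr_comp {A B C : Obj P} (g : Term B C) (f : Term A B) :
    arr (g ⊚ f) = arr f ≫ arr g := rfl

theorem arr_one (A : Obj P) : arr (one A) = 𝟙 A := rfl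

/-- The action of `⊗` on arrows. -/
def tensorArr {A B C D : Obj P} (f : A ⟶ B) (g : C ⟶ D) : (A ⊠ C) ⟶ (B ⊠ D) :=
  Quotient.map₂ (fun f g => f ⊛ g) (fun _ _ hf _ _ hg => Eqv.tensor_congr hf hg) f g

instance : MonoidalCategoryStruct (Obj P) where
  tensorObj A B := A ⊠ B
  tensorUnit := .unit
  tensorHom f g := tensorArr f g
  whiskerLeft A _ _ f := tensorArr (𝟙 A) f
  whiskerRight f A := tensorArr f (𝟙 A)
  associator A B C :=
    ⟨arr (a A B C), arr (aInv A B C), arr_eq (.aInv_a A B C), arr_eq (.a_aInv A B C)⟩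
  leftUnitor A := ⟨arr (l A), arr (lInv A), arr_eq (.lInv_l A), arr_eq (.l_lInv A)⟩
  rightUnitor A := ⟨arr (r A), arr (rInv A), arr_eq (.rInv_r A), arr_eq (.r_rInv A)⟩

instance : MonoidalCategory (Obj P) :=
  MonoidalCategory.ofTensorHom
    (id_tensorHom_id := fun A B => arr_eq (.tensor_id A B))
    (id_tensorHom := fun _ _ _ _ => rfl)
    (tensorHom_id := fun _ _ => rfl)
    (tensorHom_comp_tensorHom := fun f g f' g' => by
      obtain ⟨f, rfl⟩ := arr_surjective f
      obtain ⟨g, rfl⟩ := arr_surjective g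
      obtain ⟨f', rfl⟩ := arr_surjective f'
      obtain ⟨g', rfl⟩ := arr_surjective g'
      exact (arr_eq (.tensor_comp f' f g' g)).symm)
    (associator_naturality := fun f g h => by
      obtain ⟨f, rfl⟩ := arr_surjective f
      obtain ⟨g, rfl⟩ := arr_surjective g
      obtain ⟨h, rfl⟩ := arr_surjective h
      exact arr_eq (.a_nat f g h))
    (leftUnitor_naturality := fun f => by
      obtain ⟨f, rfl⟩ := arr_surjective f
      exact arr_eq (.l_nat f))
    (rightUnitor_naturality := fun f => by
      obtain ⟨f, rfl⟩ := arr_surjective f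
      exact arr_eq (.r_nat f))
    (pentagon := fun A B C D =>
      arr_eq ((Eqv.assoc _ _ _).trans (Eqv.pentagon A B C D).symm))
    (triangle := fun A B => arr_eq (.triangle A B))

/-- The symmetry of the free category. -/
def symm (A B : Obj P) : A ⊗ B ≅ B ⊗ A :=
  ⟨arr (c A B), arr (c B A), arr_eq (.c_c A B), arr_eq (.c_c B A)⟩

theorem symm_hexagon (A B C : Obj P) :
    (α_ A B C).hom ≫ (symm A (B ⊗ C)).hom ≫ (α_ B C A).hom =
      ((symm A B).hom ▷ C) ≫ (α_ B A C).hom ≫ (B ◁ (symm A C).hom) :=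
  arr_eq ((Eqv.assoc _ _ _).trans ((Eqv.hexagon A B C).trans (Eqv.assoc _ _ _).symm))

instance : BraidedCategory (Obj P) where
  braiding := symm
  braiding_naturality_right A _ _ f := by
    obtain ⟨f, rfl⟩ := arr_surjective f
    exact arr_eq (.c_nat (one A) f)
  braiding_naturality_left f A := by
    obtain ⟨f, rfl⟩ := arr_surjective f
    exact arr_eq (.c_nat f (one A))
  hexagon_forward := symm_hexagon
  hexagon_reverse A B C := by
    -- The inverse of a symmetry is the symmetry with its arguments swapped, so inverting the
    -- forward hexagon gives the reverse one.
    have h := congrArg (fun e : (C ⊗ A) ⊗ B ≅ A ⊗ B ⊗ C => e.inv)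
      (Iso.ext (symm_hexagon C A B) :
        α_ C A B ≪≫ symm C (A ⊗ B) ≪≫ α_ A B C =
          whiskerRightIso (symm C A) B ≪≫ α_ A C B ≪≫ whiskerLeftIso A (symm C B))
    simp only [Iso.trans_inv, Category.assoc] at h
    exact h

/-! ### Coproduct injections against the structural arrows. -/

/-- The arrow out of the initial object. -/
def bangArr (A : Obj P) : 𝟙_ (Obj P) ⟶ A := arr (bang A)

theorem arr_inj₁ (A B : Obj P) : arr (inj₁ A B) = (ρ_ A).inv ≫ (A ◁ bangArr B) := rfl

theorem arr_inj₂ (A B : Obj P) : arr (inj₂ A B) = (λ_ B).inv ≫ (bangArr A ▷ B) := rfl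

theorem bang_comp {A B : Obj P} (f : Term A B) : bangArr A ≫ arr f = bangArr B :=
  arr_eq (.bang_nat f)

theorem bang_unit_eq : bangArr (.unit : Obj P) = 𝟙 (𝟙_ (Obj P)) := arr_eq .bang_unit

theorem inj₁_tensor {A B C D : Obj P} (f : Term A B) (g : Term C D) :
    arr (inj₁ A C) ≫ arr (f ⊛ g) = arr f ≫ arr (inj₁ B D) := by
  change ((ρ_ A).inv ≫ (A ◁ bangArr C)) ≫ (arr f ⊗ₘ arr g) =
    arr f ≫ (ρ_ B).inv ≫ (B ◁ bangArr D)
  rw [← bang_comp g, MonoidalCategory.tensorHom_def, Category.assoc,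
    MonoidalCategory.whisker_exchange_assoc, MonoidalCategory.rightUnitor_inv_naturality_assoc,
    MonoidalCategory.whiskerLeft_comp]

theorem inj₂_tensor {A B C D : Obj P} (f : Term A B) (g : Term C D) :
    arr (inj₂ A C) ≫ arr (f ⊛ g) = arr g ≫ arr (inj₂ B D) := by
  change ((λ_ C).inv ≫ (bangArr A ▷ C)) ≫ (arr f ⊗ₘ arr g) =
    arr g ≫ (λ_ D).inv ≫ (bangArr B ▷ D)
  rw [← bang_comp f, MonoidalCategory.tensorHom_def', Category.assoc,
    ← MonoidalCategory.whisker_exchange_assoc, MonoidalCategory.leftUnitor_inv_naturality_assoc,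
    MonoidalCategory.comp_whiskerRight]

theorem inj₁_c (A B : Obj P) : arr (inj₁ A B) ≫ arr (c A B) = arr (inj₂ B A) := by
  change _ ≫ (β_ A B).hom = _
  rw [arr_inj₁, arr_inj₂, Category.assoc, BraidedCategory.braiding_naturality_right,
    ← Category.assoc, rightUnitor_inv_braiding]

theorem inj₂_c (A B : Obj P) : arr (inj₂ A B) ≫ arr (c A B) = arr (inj₁ B A) := by
  change _ ≫ (β_ A B).hom = _
  rw [arr_inj₁, arr_inj₂, Category.assoc, BraidedCategory.braiding_naturality_left,
    ← Category.assoc, leftUnitor_inv_braiding]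

theorem inj₁_a (A B C : Obj P) :
    arr (inj₁ (A ⊠ B) C) ≫ arr (a A B C) = arr (one A ⊛ inj₁ B C) := by
  change ((ρ_ (A ⊗ B)).inv ≫ ((A ⊗ B) ◁ bangArr C)) ≫ (α_ A B C).hom =
    A ◁ ((ρ_ B).inv ≫ (B ◁ bangArr C))
  simp

/-- By initiality the arrow factors through `inj₁ A B`, and the two unitors agree at the unit. This
splits `!` so that coherence can finish `inj₂_a`. -/
theorem bang_tensor (A B : Obj P) :
    bangArr (A ⊠ B) = (λ_ (𝟙_ (Obj P))).inv ≫ (bangArr A ⊗ₘ bangArr B) := by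
  change _ = _ ≫ (_ ⊗ₘ _)
  rw [← bang_comp (inj₁ A B), arr_inj₁, MonoidalCategory.tensorHom_def, unitors_inv_equal,
    MonoidalCategory.rightUnitor_inv_naturality_assoc]

theorem inj₂_a (A B C : Obj P) :
    arr (inj₂ (A ⊠ B) C) ≫ arr (a A B C) = arr (inj₂ B C) ≫ arr (inj₂ A (B ⊠ C)) := by
  rw [arr_inj₂, arr_inj₂, arr_inj₂, bang_tensor]
  change ((λ_ C).inv ≫ (((λ_ (𝟙_ (Obj P))).inv ≫ (bangArr A ⊗ₘ bangArr B)) ▷ C)) ≫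
    (α_ A B C).hom = ((λ_ C).inv ≫ (bangArr B ▷ C)) ≫
      (λ_ (B ⊗ C)).inv ≫ (bangArr A ▷ (B ⊗ C))
  simp [MonoidalCategory.tensorHom_def']

theorem inj₁_codiag (A : Obj P) : arr (inj₁ A A) ≫ arr (codiag A) = 𝟙 A :=
  arr_eq (.codiag_inj₁ A)

theorem inj₂_codiag (A : Obj P) : arr (inj₂ A A) ≫ arr (codiag A) = 𝟙 A :=
  arr_eq (.codiag_inj₂ A)

theorem inj₁_r (A : Obj P) : arr (inj₁ A .unit) = arr (rInv A) := by
  rw [arr_inj₁, bang_unit_eq, MonoidalCategory.whiskerLeft_id]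
  exact Category.comp_id _

theorem inj₂_l (A : Obj P) : arr (inj₂ .unit A) = arr (lInv A) := by
  rw [arr_inj₂, bang_unit_eq, MonoidalCategory.id_whiskerRight]
  exact Category.comp_id _

/-! ### The strengths on injections, and joint epimorphy of the injections. -/

theorem arr_η_nat {A B : Obj P} (f : Term A B) :
    arr f ≫ arr (η B) = arr (η A) ≫ arr (T f) :=
  (arr_eq (.η_nat f)).symm

/-- Naturality in the second argument reduces to `B = I`, where `Tr ∘ ψL = r` determines the
strength. -/
theorem inj₁_ψL (A B : Obj P) : arr (inj₁ A.T B) ≫ arr (ψL A B) = arr (T (inj₁ A B)) := by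
  have h : arr (one A.T ⊛ bang B) ≫ arr (ψL A B) =
      arr (ψL A .unit) ≫ arr (T (one A ⊛ bang B)) :=
    (arr_eq ((Eqv.ψL_nat (one A) (bang B)).trans
      (.comp_congr (.refl _) (.tensor_congr (.T_id A) (.refl _))))).symm
  have h' : arr (rInv A.T) ≫ arr (ψL A .unit) = arr (T (rInv A)) := by
    have e : arr (T (r A)) ≫ arr (T (rInv A)) = 𝟙 _ :=
      arr_eq ((Eqv.T_comp _ _).symm.trans ((Eqv.T_congr (.rInv_r A)).trans (.T_id _)))
    have e₁ : arr (ψL A .unit) ≫ arr (T (r A)) = arr (r A.T) := arr_eq (.ψL_r A)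
    have e₂ : arr (rInv A.T) ≫ arr (r A.T) = 𝟙 _ := arr_eq (.r_rInv A.T)
    rw [← Category.comp_id (arr (ψL A .unit)), ← e, reassoc_of% e₁, reassoc_of% e₂]
  rw [inj₁, arr_comp, Category.assoc, h, reassoc_of% h']
  exact (arr_eq (.T_comp _ _)).symm

theorem inj₂_ψR (A B : Obj P) : arr (inj₂ A B.T) ≫ arr (ψR A B) = arr (T (inj₂ A B)) := by
  have h : arr (bang A ⊛ one B.T) ≫ arr (ψR A B) =
      arr (ψR .unit B) ≫ arr (T (bang A ⊛ one B)) :=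
    (arr_eq ((Eqv.ψR_nat (bang A) (one B)).trans
      (.comp_congr (.refl _) (.tensor_congr (.refl _) (.T_id B))))).symm
  have h' : arr (lInv B.T) ≫ arr (ψR .unit B) = arr (T (lInv B)) := by
    have e : arr (T (l B)) ≫ arr (T (lInv B)) = 𝟙 _ :=
      arr_eq ((Eqv.T_comp _ _).symm.trans ((Eqv.T_congr (.lInv_l B)).trans (.T_id _)))
    have e₁ : arr (ψR .unit B) ≫ arr (T (l B)) = arr (l B.T) := arr_eq (.ψR_l B)
    have e₂ : arr (lInv B.T) ≫ arr (l B.T) = 𝟙 _ := arr_eq (.l_lInv B.T)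
    rw [← Category.comp_id (arr (ψR .unit B)), ← e, reassoc_of% e₁, reassoc_of% e₂]
  rw [inj₂, arr_comp, Category.assoc, h, reassoc_of% h']
  exact (arr_eq (.T_comp _ _)).symm

/-- The injection into `T A ⊗ B` factors through `η ⊗ 1`, on which the strength is `η`. -/
theorem inj₂_ψL (A B : Obj P) :
    arr (inj₂ A.T B) ≫ arr (ψL A B) = arr (inj₂ A B) ≫ arr (η (A ⊠ B)) := by
  have e : arr (η A ⊛ one B) ≫ arr (ψL A B) = arr (η (A ⊠ B)) := arr_eq (.ψL_η A B)
  rw [← e, reassoc_of% (inj₂_tensor (η A) (one B)), arr_one, Category.id_comp]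

theorem inj₁_ψR (A B : Obj P) :
    arr (inj₁ A B.T) ≫ arr (ψR A B) = arr (inj₁ A B) ≫ arr (η (A ⊠ B)) := by
  have e : arr (one A ⊛ η B) ≫ arr (ψR A B) = arr (η (A ⊠ B)) := arr_eq (.ψR_η A B)
  rw [← e, reassoc_of% (inj₁_tensor (one A) (η B)), arr_one, Category.id_comp]

/-- Arrows out of `A ⊗ B` are determined by their composites with the injections. -/
theorem tensor_hom_ext {A B C : Obj P} {f g : Term (A ⊠ B) C}
    (h₁ : arr (inj₁ A B) ≫ arr f = arr (inj₁ A B) ≫ arr g)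
    (h₂ : arr (inj₂ A B) ≫ arr f = arr (inj₂ A B) ≫ arr g) : arr f = arr g := by
  -- Every arrow is the copairing of its restrictions, by naturality of `∇` and `∇ ∘ (ι¹ ⊗ ι²) = 1`.
  have key : ∀ k : Term (A ⊠ B) C,
      arr k = tensorArr (arr (inj₁ A B) ≫ arr k) (arr (inj₂ A B) ≫ arr k) ≫
        arr (codiag C) := by
    intro k
    have e₁ : arr (inj₁ A B ⊛ inj₂ A B) ≫ arr (codiag (A ⊠ B)) = 𝟙 _ :=
      arr_eq (.codiag_inj A B)
    have e₂ : arr (codiag (A ⊠ B)) ≫ arr k = arr (k ⊛ k) ≫ arr (codiag C) :=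
      arr_eq (.codiag_nat k)
    have e₃ : arr (inj₁ A B ⊛ inj₂ A B) ≫ arr (k ⊛ k) =
        tensorArr (arr (inj₁ A B) ≫ arr k) (arr (inj₂ A B) ≫ arr k) :=
      (arr_eq (.tensor_comp k (inj₁ A B) k (inj₂ A B))).symm
    rw [← e₃, Category.assoc, ← e₂, reassoc_of% e₁]
  rw [key f, key g, h₁, h₂]

/-! ### Canonical arrows and the normal form. -/

/-- The canonical arrow into `D` determined by an occurrence of a letter or of `T` in `D`: its
source is the subformula of `D` with that occurrence as its outermost symbol. -/
def can : (D : Obj P) → Pos D → Σ S : Obj P, Term S D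
  | .letter p => fun _ => ⟨.letter p, one _⟩
  | .unit => fun x : Empty => x.elim
  | .tensor A B => fun x : Pos A ⊕ Pos B =>
      Sum.elim (fun x => ⟨(can A x).1, inj₁ A B ⊚ (can A x).2⟩)
        (fun x => ⟨(can B x).1, inj₂ A B ⊚ (can B x).2⟩) x
  | .T A => fun x : Option (Pos A) =>
      Option.elim x ⟨.T A, one _⟩ fun x => ⟨(can A x).1, η A ⊚ (can A x).2⟩

/-- An arrow is normal if it is the canonical arrow of an occurrence of a letter, or the composite
of a Kleisli extension with the canonical arrow of an occurrence of `T`. -/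
inductive IsNormal {D : Obj P} : {S : Obj P} → (S ⟶ D) → Prop
  | letter {p : P} (k : Term (.letter p) D) (y : Pos D) (hk : can D y = ⟨.letter p, k⟩) :
      IsNormal (arr k)
  | ext {A C : Obj P} (g : Term A C.T) (k : Term C.T D) (y : Pos D) (hk : can D y = ⟨C.T, k⟩) :
      IsNormal (arr (T g) ≫ arr (μ C) ≫ arr k)

theorem can_source (D : Obj P) (y : Pos D) :
    (∃ p, (can D y).1 = .letter p) ∨ ∃ C, (can D y).1 = .T C := by
  induction D with
  | letter p => exact .inl ⟨p, rfl⟩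
  | unit => exact Empty.elim y
  | tensor A B ihA ihB =>
    rcases (y : Pos A ⊕ Pos B) with y | y
    · exact ihA y
    · exact ihB y
  | T A ih =>
    rcases (y : Option (Pos A)) with _ | y
    · exact .inr ⟨A, rfl⟩
    · exact ih y

/-- When the source is `T C`, the law `μ ∘ Tη = 1` inserts the trivial Kleisli extension. -/
theorem isNormal_can (D : Obj P) (y : Pos D) : IsNormal (arr (can D y).2) := by
  have h := can_source D y
  generalize hk : can D y = s at h
  obtain ⟨S, k⟩ := s
  rcases h with ⟨p, rfl⟩ | ⟨C, rfl⟩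
  · exact .letter k y hk
  · have e : arr (T (η C)) ≫ arr (μ C) = 𝟙 _ := arr_eq (.μ_Tη C)
    have h' := IsNormal.ext (η C) k y hk
    rwa [reassoc_of% e] at h'

/-- Associativity of Kleisli composition: the extensions of `g` and `g'` merge into that of `μ ∘ T
g' ∘ g`. -/
theorem IsNormal.ext_comp {A C D : Obj P} (g : Term A C.T) {h : C.T ⟶ D} (hh : IsNormal h) :
    IsNormal (arr (T g) ≫ arr (μ C) ≫ h) := by
  cases hh with
  | @ext _ E g' k y hk =>
    have e₁ : arr (μ C) ≫ arr (T g') = arr (T (T g')) ≫ arr (μ E.T) := arr_eq (.μ_nat g')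
    have e₂ : arr (μ E.T) ≫ arr (μ E) = arr (T (μ E)) ≫ arr (μ E) := arr_eq (.μ_μ E)
    have e₃ : arr (T (μ E ⊚ T g' ⊚ g)) = arr (T g) ≫ arr (T (T g')) ≫ arr (T (μ E)) := by
      rw [arr_eq (.T_comp _ _), arr_comp, arr_eq (.T_comp _ _), arr_comp, Category.assoc]
    rw [reassoc_of% e₁, reassoc_of% e₂]
    have h' := IsNormal.ext (μ E ⊚ T g' ⊚ g) k y hk
    rwa [e₃, Category.assoc, Category.assoc] at h'

/-- An arrow whose composites with all canonical arrows are normal preserves normality. -/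
theorem IsNormal.comp {S B D : Obj P} {h : S ⟶ B} (hh : IsNormal h) {f : B ⟶ D}
    (hf : ∀ y, IsNormal (arr (can B y).2 ≫ f)) : IsNormal (h ≫ f) := by
  cases hh with
  | letter k y hk =>
    have := hf y
    rwa [hk] at this
  | ext g k y hk =>
    have := hf y
    rw [hk] at this
    simpa only [Category.assoc] using this.ext_comp g

theorem IsNormal.inj₁ {S A : Obj P} {h : S ⟶ A} (hh : IsNormal h) (B : Obj P) :
    IsNormal (h ≫ arr (inj₁ A B)) :=
  hh.comp fun y => isNormal_can (A ⊠ B) (Sum.inl y : Pos A ⊕ Pos B)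

theorem IsNormal.inj₂ {S B : Obj P} {h : S ⟶ B} (hh : IsNormal h) (A : Obj P) :
    IsNormal (h ≫ arr (inj₂ A B)) :=
  hh.comp fun y => isNormal_can (A ⊠ B) (Sum.inr y : Pos A ⊕ Pos B)

theorem IsNormal.η {S A : Obj P} {h : S ⟶ A} (hh : IsNormal h) :
    IsNormal (h ≫ arr (η A)) :=
  hh.comp fun y => isNormal_can A.T (some y : Option (Pos A))

theorem isNormal_T {A B : Obj P} (f : Term A B) : IsNormal (arr (T f)) := by
  have e₁ : arr (T (Term.η B)) ≫ arr (μ B) = 𝟙 _ := arr_eq (.μ_Tη B)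
  have e₂ : arr (T (Term.η B ⊚ f)) = arr (T f) ≫ arr (T (Term.η B)) := arr_eq (.T_comp _ _)
  have h := IsNormal.ext (Term.η B ⊚ f) (one B.T) (none : Option (Pos B)) rfl
  rwa [e₂, Category.assoc, reassoc_of% e₁, arr_one, Category.comp_id] at h

theorem isNormal_id_T (A : Obj P) : IsNormal (𝟙 A.T) :=
  isNormal_can A.T (none : Option (Pos A))

/-- Allowing any arrow `f`, not just one presented by a term, lets this be iterated on nested
tensors. -/
theorem forall_pos_tensor {A B D : Obj P} {f : (A ⊠ B) ⟶ D}
    (h₁ : ∀ x, IsNormal (arr (can A x).2 ≫ arr (inj₁ A B) ≫ f))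
    (h₂ : ∀ x, IsNormal (arr (can B x).2 ≫ arr (inj₂ A B) ≫ f)) (x : Pos (A ⊠ B)) :
    IsNormal (arr (can (A ⊠ B) x).2 ≫ f) := by
  rcases (x : Pos A ⊕ Pos B) with x | x
  · exact (Category.assoc (arr (can A x).2) (arr (inj₁ A B)) f) ▸ h₁ x
  · exact (Category.assoc (arr (can B x).2) (arr (inj₂ A B)) f) ▸ h₂ x

theorem forall_pos_T {A D : Obj P} {f : A.T ⟶ D} (h₁ : IsNormal f)
    (h₂ : ∀ x, IsNormal (arr (can A x).2 ≫ arr (η A) ≫ f)) (x : Pos A.T) :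
    IsNormal (arr (can A.T x).2 ≫ f) := by
  rcases (x : Option (Pos A)) with _ | x
  · exact (Category.id_comp f).symm ▸ h₁
  · exact (Category.assoc (arr (can A x).2) (arr (η A)) f) ▸ h₂ x

/-- Composites of canonical arrows with arbitrary arrows are normal. -/
theorem isNormal_can_comp {B D : Obj P} (f : Term B D) :
    ∀ x, IsNormal (arr (can B x).2 ≫ arr f) := by
  induction f with
  | one A =>
    intro x
    rw [arr_one, Category.comp_id]
    exact isNormal_can A x
  | comp g f ihg ihf =>
    intro x
    rw [arr_comp, ← Category.assoc]
    exact (ihf x).comp ihg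
  | tensor f g ihf ihg =>
    refine forall_pos_tensor (fun x => ?_) (fun x => ?_)
    · rw [inj₁_tensor, ← Category.assoc]
      exact (ihf x).inj₁ _
    · rw [inj₂_tensor, ← Category.assoc]
      exact (ihg x).inj₂ _
  | a A B C =>
    refine forall_pos_tensor ?_ (fun x => ?_)
    · rw [inj₁_a]
      refine forall_pos_tensor (fun x => ?_) (fun x => ?_)
      · rw [inj₁_tensor, arr_one, Category.id_comp]
        exact (isNormal_can A x).inj₁ _
      · rw [inj₂_tensor, ← Category.assoc]
        exact ((isNormal_can B x).inj₁ _).inj₂ _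
    · rw [inj₂_a, ← Category.assoc]
      exact ((isNormal_can C x).inj₂ _).inj₂ _
  | aInv A B C =>
    -- Injections into `A ⊗ (B ⊗ C)` are rewritten to end in `a`, which then cancels.
    have e : arr (a A B C) ≫ arr (aInv A B C) = 𝟙 _ := arr_eq (.aInv_a A B C)
    refine forall_pos_tensor (fun x => ?_) ?_
    · have e₁ : arr (inj₁ A (B ⊠ C)) =
          arr (inj₁ A B) ≫ arr (inj₁ (A ⊠ B) C) ≫ arr (a A B C) := by
        rw [inj₁_a, inj₁_tensor, arr_one, Category.id_comp]
      rw [e₁, Category.assoc, Category.assoc, e, Category.comp_id, ← Category.assoc]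
      exact ((isNormal_can A x).inj₁ _).inj₁ _
    · refine forall_pos_tensor (fun x => ?_) (fun x => ?_)
      · have e₁ : arr (inj₁ B C) ≫ arr (inj₂ A (B ⊠ C)) =
            arr (inj₂ A B) ≫ arr (inj₁ (A ⊠ B) C) ≫ arr (a A B C) := by
          rw [inj₁_a, inj₂_tensor]
        rw [reassoc_of% e₁, e, Category.comp_id, ← Category.assoc]
        exact ((isNormal_can B x).inj₂ _).inj₁ _
      · rw [← reassoc_of% (inj₂_a A B C), e, Category.comp_id]
        exact (isNormal_can C x).inj₂ _
  | l A =>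
    refine forall_pos_tensor (fun x => Empty.elim x) (fun x => ?_)
    have e : arr (lInv A) ≫ arr (l A) = 𝟙 _ := arr_eq (.l_lInv A)
    rw [inj₂_l, e, Category.comp_id]
    exact isNormal_can A x
  | lInv A =>
    intro x
    rw [← inj₂_l]
    exact (isNormal_can A x).inj₂ _
  | r A =>
    refine forall_pos_tensor (fun x => ?_) (fun x => Empty.elim x)
    have e : arr (rInv A) ≫ arr (r A) = 𝟙 _ := arr_eq (.r_rInv A)
    rw [inj₁_r, e, Category.comp_id]
    exact isNormal_can A x
  | rInv A =>
    intro x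
    rw [← inj₁_r]
    exact (isNormal_can A x).inj₁ _
  | c A B =>
    refine forall_pos_tensor (fun x => ?_) (fun x => ?_)
    · rw [inj₁_c]
      exact (isNormal_can A x).inj₂ _
    · rw [inj₂_c]
      exact (isNormal_can B x).inj₁ _
  | codiag A =>
    refine forall_pos_tensor (fun x => ?_) (fun x => ?_)
    · rw [inj₁_codiag, Category.comp_id]
      exact isNormal_can A x
    · rw [inj₂_codiag, Category.comp_id]
      exact isNormal_can A x
  | bang A => exact fun x => Empty.elim x
  | T f ih =>
    refine forall_pos_T (isNormal_T f) (fun x => ?_)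
    rw [← arr_η_nat, ← Category.assoc]
    exact (ih x).η
  | η A => exact fun x => (isNormal_can A x).η
  | μ A =>
    have e : arr (η A.T) ≫ arr (μ A) = 𝟙 _ := arr_eq (.μ_η A)
    refine forall_pos_T ?_ ?_
    -- `μ` is the Kleisli extension of the identity of `T A`.
    · have h := (isNormal_id_T A).ext_comp (one A.T)
      rwa [arr_eq (.T_id A.T), arr_one, Category.id_comp, Category.comp_id] at h
    · rw [e]
      intro x
      rw [Category.comp_id]
      exact isNormal_can A.T x
  | ψL A B =>
    refine forall_pos_tensor ?_ (fun x => ?_)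
    · rw [inj₁_ψL]
      refine forall_pos_T (isNormal_T _) (fun x => ?_)
      rw [← arr_η_nat, ← Category.assoc]
      exact ((isNormal_can A x).inj₁ _).η
    · rw [inj₂_ψL, ← Category.assoc]
      exact ((isNormal_can B x).inj₂ _).η
  | ψR A B =>
    refine forall_pos_tensor (fun x => ?_) ?_
    · rw [inj₁_ψR, ← Category.assoc]
      exact ((isNormal_can A x).inj₁ _).η
    · rw [inj₂_ψR]
      refine forall_pos_T (isNormal_T _) (fun x => ?_)
      rw [← arr_η_nat, ← Category.assoc]
      exact ((isNormal_can B x).inj₂ _).η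

/-! ### Recovering the normal form from the function on occurrences. -/

/-- The outermost occurrence in the source of a canonical arrow. -/
def root : (S : Obj P) → Set (Pos S)
  | .letter _ => Set.univ
  | .unit => ∅
  | .tensor _ _ => ∅
  | .T A => {x : Option (Pos A) | x = none}

/-- This reads `y` off the function. By `can_source` the source is a letter or some `T C`, so its
root is never empty. -/
theorem act_can_root (D : Obj P) (y : Pos D) :
    ∀ x ∈ root (can D y).1, act (can D y).2 x = y := by
  induction D with
  | letter p => exact fun _ _ => rfl
  | unit => exact Empty.elim y
  | tensor A B ihA ihB =>
    rcases (y : Pos A ⊕ Pos B) with y | y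
    · exact fun x hx => congrArg Sum.inl (ihA y x hx)
    · exact fun x hx => congrArg Sum.inr (ihB y x hx)
  | T A ih =>
    rcases (y : Option (Pos A)) with _ | y
    · exact fun x hx => hx
    · exact fun x hx => congrArg some (ih y x hx)

theorem act_can_injective (D : Obj P) (y : Pos D) : Function.Injective (act (can D y).2) := by
  induction D with
  | letter p => exact Function.injective_id
  | unit => exact Empty.elim y
  | tensor A B ihA ihB =>
    rcases (y : Pos A ⊕ Pos B) with y | y
    · exact Sum.inl_injective.comp (ihA y)
    · exact Sum.inr_injective.comp (ihB y)
  | T A ih =>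
    rcases (y : Option (Pos A)) with _ | y
    · exact Function.injective_id
    · exact (Option.some_injective _).comp (ih y)

theorem eqv_of_arr_eq {A B : Obj P} {f g : Term A B} (h : arr f = arr g) : Eqv f g :=
  Quotient.exact h

theorem act_congr {A B : Obj P} {f g : Term A B} (h : arr f = arr g) : act f = act g :=
  act_eq (eqv_of_arr_eq h)

theorem exists_of_isNormal_letter {p : P} {D : Obj P} {h : Obj.letter p ⟶ D} (hh : IsNormal h) :
    ∃ (k : Term (.letter p) D) (y : Pos D), can D y = ⟨.letter p, k⟩ ∧ h = arr k := by
  cases hh with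
  | letter k y hk => exact ⟨k, y, hk, rfl⟩

theorem exists_of_isNormal_T {A D : Obj P} {h : A.T ⟶ D} (hh : IsNormal h) :
    ∃ (C : Obj P) (g : Term A C.T) (k : Term C.T D) (y : Pos D),
      can D y = ⟨C.T, k⟩ ∧ h = arr (k ⊚ μ C ⊚ T g) := by
  cases hh with
  | ext g k y hk => exact ⟨_, g, k, y, hk, (Category.assoc _ _ _).symm⟩

/-- Arrow terms with the same function on occurrences are equal. -/
theorem arr_eq_of_act_eq {A D : Obj P} (f g : Term A D) (h : act f = act g) :
    arr f = arr g := by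
  induction A generalizing D with
  | letter p =>
    have key : ∀ f : Term (.letter p) D, ∃ (k : Term (.letter p) D) (y : Pos D),
        can D y = ⟨.letter p, k⟩ ∧ arr f = arr k := fun f =>
      -- The canonical arrow of a letter into itself is the identity, so `f` itself is normal.
      exists_of_isNormal_letter (Category.id_comp (arr f) ▸ isNormal_can_comp f ())
    have root_eq : ∀ {k : Term (.letter p) D} {y : Pos D}, can D y = ⟨.letter p, k⟩ →
        act k () = y := fun {k y} hk => by
      have := act_can_root D y
      rw [hk] at this
      exact this () trivial
    obtain ⟨k, y, hk, hf⟩ := key f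
    obtain ⟨k', y', hk', hg⟩ := key g
    have hy : y = y' := by
      rw [← root_eq hk, ← root_eq hk', ← act_congr hf, ← act_congr hg, h]
    subst hy
    obtain rfl : k = k' := eq_of_heq (Sigma.mk.inj (hk.symm.trans hk')).2
    rw [hf, hg]
  | unit =>
    have key : ∀ f : Term .unit D, arr f = bangArr D := fun f => by
      rw [← bang_comp f, bang_unit_eq]
      exact (Category.id_comp _).symm
    rw [key f, key g]
  | tensor A B ihA ihB =>
    refine tensor_hom_ext (ihA (f ⊚ inj₁ A B) (g ⊚ inj₁ A B) ?_)
      (ihB (f ⊚ inj₂ A B) (g ⊚ inj₂ A B) ?_)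
    · exact congrArg (fun k x => k (act (inj₁ A B) x)) h
    · exact congrArg (fun k x => k (act (inj₂ A B) x)) h
  | T A ih =>
    have key : ∀ f : Term A.T D, ∃ (C : Obj P) (g : Term A C.T) (k : Term C.T D) (y : Pos D),
        can D y = ⟨C.T, k⟩ ∧ arr f = arr (k ⊚ μ C ⊚ T g) := fun f =>
      exists_of_isNormal_T
        (Category.id_comp (arr f) ▸ isNormal_can_comp f (none : Option (Pos A)))
    have root_eq : ∀ {C : Obj P} {k : Term C.T D} {y : Pos D}, can D y = ⟨C.T, k⟩ →
        act k (none : Option (Pos C)) = y := fun {C k y} hk => by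
      have := act_can_root D y
      rw [hk] at this
      exact this (none : Option (Pos C)) rfl
    obtain ⟨C, f', k, y, hk, hf⟩ := key f
    obtain ⟨C', g', k', y', hk', hg⟩ := key g
    have hfg := (act_congr hf).symm.trans (h.trans (act_congr hg))
    have hy : y = y' := by
      rw [← root_eq hk, ← root_eq hk']
      -- Both `T f'` and `μ` preserve the outermost `T`, so evaluation there gives the value of `k`
      -- at its root.
      exact congrFun hfg (none : Option (Pos A))
    subst hy
    have hs := Sigma.mk.inj (hk.symm.trans hk')
    obtain rfl : C = C' := Obj.T.inj hs.1
    obtain rfl : k = k' := eq_of_heq hs.2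
    have hinj : Function.Injective (act k) := by
      have := act_can_injective D y
      rwa [hk] at this
    have hact : act f' = act g' := by
      funext x
      -- On occurrences inside `A`, `μ ∘ T f'` acts as `f'`.
      exact hinj (congrFun hfg (some x : Option (Pos A)))
    have hT : arr (T f') = arr (T g') := arr_eq (.T_congr (eqv_of_arr_eq (ih f' g' hact)))
    rw [hf, hg, arr_comp, arr_comp, hT]
    rfl

theorem act_eq_of_graph_eq {A B : Obj P} {f g : Term A B} (h : graph f = graph g) :
    act f = act g := by
  funext x
  have := congrFun h (posEquiv A x)
  simpa [graph] using this

end CocartesianMonad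

theorem mainTheorem7 (P : Type*) : (CocartesianMonad.G P).Faithful := by
  refine ⟨fun {A B} f g h => ?_⟩
  obtain ⟨f, rfl⟩ := CocartesianMonad.arr_surjective (A := A) (B := B) f
  obtain ⟨g, rfl⟩ := CocartesianMonad.arr_surjective (A := A) (B := B) g
  refine CocartesianMonad.arr_eq_of_act_eq f g (CocartesianMonad.act_eq_of_graph_eq ?_)
  funext i
  exact congrArg ULift.down (congrFun h ⟨i⟩)
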